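/- For a compact complex manifold $M$ (Hausdorff, non-empty) with a Kähler metric form $\omega$ (a smooth, closed, positive real $(1,1)$-form), call a smooth function $\varphi : M \to \mathbb{R}$ $\omega$-admissible if $\omega + i\,\partial\bar\partial\varphi > 0$. Let $dV$ be the Riemannian volume measure of the metric. Define Tian's invariant $\alpha(\omega) \in [0, +\infty]$ as the supremum of the set of real numbers $a \ge 0$ for which there is a constant $C$ such that $$\int_M e^{-a\varphi}\, dV \le C$$ for all $\omega$-admissible functions $\varphi$ with $\sup_M \varphi \ge 0$. **Proposition.** Let $M_1, \dots, M_n$ ($n \ge 1$) be compact Kähler manifolds with metric forms $\omega_1, \dots, \omega_n$, and endow $M_1 \times \dots \times M_n$ with the metric form $\omega_1 \oplus \dots \oplus \omega_n$, the sum of the pullbacks of the $\omega_i$ under the projections. Then $$\alpha(\omega_1 \oplus \dots \oplus \omega_n) = \min_{1 \le i \le n} \alpha(\omega_i).$$ -/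

import Mathlib

open scoped ContDiff Manifold NNReal ENNReal
open MeasureTheory

noncomputable section

/-- A real 2-form on a complex manifold `M` modelled on `E` (no regularity required).  As for
Mathlib's `TangentSpace 𝓘(ℂ, E) x`, which is `E` by definition, the tangent space at `x` is
identified with `E` by the preferred chart `chartAt E x`.  The complex structure `J` is
multiplication by `Complex.I`. -/
abbrev TwoForm (E M : Type*) [NormedAddCommGroup E] [NormedSpace ℂ E] :=
  M → E [⋀^Fin 2]→L[ℝ] ℝ

section Single

variable {E M : Type*} [NormedAddCommGroup E] [NormedSpace ℂ E] [TopologicalSpace M]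
  [ChartedSpace E M]

/-- The expression of the 2-form `Ω` in the chart `e`: the pullback of `Ω` by `e.symm`, a 2-form on
`e.target` (junk outside `e.target`).  The derivative of `e.symm` at `z`, as a map to the tangent
space at `x = e.symm z`, is the derivative of the transition map from `e` to `chartAt E x`. -/
def TwoForm.inChart (Ω : TwoForm E M) (e : OpenPartialHomeomorph M E) (z : E) :
    E [⋀^Fin 2]→L[ℝ] ℝ :=
  (Ω (e.symm z)).compContinuousLinearMap (fderiv ℝ (chartAt E (e.symm z) ∘ e.symm) z)

/-- `Ω` is a Kähler metric form: a smooth closed real 2-form of type (1,1), positive on complex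
lines. -/
structure IsKahlerForm (Ω : TwoForm E M) : Prop where
  smooth : ∀ e ∈ atlas E M, ContDiffOn ℝ ∞ (Ω.inChart e) e.target
  closed : ∀ e ∈ atlas E M, ∀ z ∈ e.target, extDeriv (Ω.inChart e) z = 0
  type_one_one : ∀ (x : M) (v w : E),
    Ω x ![Complex.I • v, Complex.I • w] = Ω x ![v, w]
  pos : ∀ (x : M) (v : E), v ≠ 0 → 0 < Ω x ![v, Complex.I • v]

/-- The value at `x` of the real 2-form `i ∂∂̄φ` on the tangent vectors `v`, `w`.  A tangent
vector at `x` is a vector of `E` through the preferred chart at `x`; if `ψ` is the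
expression of `φ` in that chart, then
`i ∑ ∂²ψ/∂z^λ∂z̄^μ (dz^λ ∧ dz̄^μ)(v, w) = (D²ψ(w, J v) - D²ψ(v, J w)) / 2`. -/
def iddbar (φ : M → ℝ) (x : M) (v w : E) : ℝ :=
  let D2 : E →L[ℝ] E →L[ℝ] ℝ :=
    fderiv ℝ (fderiv ℝ (φ ∘ (chartAt E x).symm)) (chartAt E x x)
  (D2 w (Complex.I • v) - D2 v (Complex.I • w)) / 2

/-- `φ` is `Ω`-admissible: `φ` is a (real) smooth function and `Ω + i ∂∂̄φ > 0`. -/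
structure IsAdmissible (Ω : TwoForm E M) (φ : M → ℝ) : Prop where
  smooth : ContMDiff 𝓘(ℝ, E) 𝓘(ℝ, ℝ) ∞ φ
  pos : ∀ (x : M) (v : E), v ≠ 0 →
    0 < Ω x ![v, Complex.I • v] + iddbar φ x v (Complex.I • v)

variable [FiniteDimensional ℂ E]

/-- The density `√(det g)` of the Riemannian metric `g(v, w) = Ω(v, J w)` in the chart `e`,
with respect to the real linear coordinates of `E` given by the basis `Module.finBasis ℝ E`. -/
def TwoForm.density (Ω : TwoForm E M) (e : OpenPartialHomeomorph M E) (z : E) : ℝ :=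
  √(Matrix.det (Matrix.of fun i j : Fin (Module.finrank ℝ E) =>
    Ω.inChart e z ![Module.finBasis ℝ E i, Complex.I • Module.finBasis ℝ E j]))

/-- The measure `√(det g) dx` on `e.target`, transported to `e.source`. Here `dx` is the Lebesgue
measure in the real coordinates given by `Module.finBasis ℝ E`. -/
def TwoForm.chartVolume (Ω : TwoForm E M) [MeasurableSpace M] (e : OpenPartialHomeomorph M E) :
    Measure M :=
  letI : MeasurableSpace E := borel E
  haveI : BorelSpace E := ⟨rfl⟩
  (((Module.finBasis ℝ E).addHaar.restrict e.target).withDensity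
    fun z => ENNReal.ofReal (Ω.density e z)).map e.symm

/-- The Riemannian volume measure `dV` of the metric with form `Ω` (that is, `Ω ^ m / m!` if
`m` is the complex dimension).  The measures `chartVolume` are the restrictions of `dV` to the chart
domains; `dV` is their supremum in the complete lattice of measures. -/
def TwoForm.volume (Ω : TwoForm E M) [MeasurableSpace M] : Measure M :=
  ⨆ e ∈ atlas E M, Ω.chartVolume e

/-- The invariant `α(Ω) ∈ [0, ∞]`: the supremum of the nonnegative real numbers `a` for which there
is a constant `C` such that `∫ exp (-a φ) dV ≤ C` for all `Ω`-admissible `φ` with `sup φ ≥ 0`. -/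
def TwoForm.alpha (Ω : TwoForm E M) [MeasurableSpace M] : ℝ≥0∞ :=
  ⨆ (a : ℝ≥0) (_ : ∃ C : ℝ≥0, ∀ φ : M → ℝ, IsAdmissible Ω φ → 0 ≤ ⨆ x, φ x →
    ∫⁻ x, ENNReal.ofReal (Real.exp (-(a * φ x))) ∂Ω.volume ≤ C), (a : ℝ≥0∞)

end Single

section Product

variable {ι : Type*} [Fintype ι] {E M : ι → Type*} [∀ i, NormedAddCommGroup (E i)]
  [∀ i, NormedSpace ℂ (E i)] [∀ i, TopologicalSpace (M i)] [∀ i, ChartedSpace (E i) (M i)]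

/-- The product of manifolds `M i` modelled on `E i`, as a manifold modelled on `∀ i, E i`:
Mathlib's product charted space (`ModelPi E` is by definition `∀ i, E i`). -/
instance (priority := low) piModelChartedSpace : ChartedSpace (∀ i, E i) (∀ i, M i) :=
  piChartedSpace E M

/-- The product form `Ω₁ ⊕ … ⊕ Ωₙ`, the sum of the pullbacks of the `Ω i` under the projections. -/
def TwoForm.directSum (Ω : ∀ i, TwoForm (E i) (M i)) : TwoForm (∀ i, E i) (∀ i, M i) :=
  fun x => ∑ i, (Ω i (x i)).compContinuousLinearMap
    (ContinuousLinearMap.proj i)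

end Product

end

open scoped ContDiff Manifold NNReal ENNReal
open MeasureTheory

noncomputable section

/-! ### Determinants of the metric and their dependence on the basis -/

section LinearAlgebra

/-! The proof is Fubini plus two ways of transporting admissible functions. The volume of the
product metric is the product measure (`TwoForm.volume_directSum`): the metric determinant in a
product chart is the product of those of the factors.

For `≤`, an admissible function on one factor, pulled back by the projection, is admissible on the
product with the same supremum (`IsAdmissible.comp_eval`). Its exponential integral is only
multiplied by the volume of the other factors, which is positive and finite.

For `≥`, subtracting `φ p` turns the uniform bound on a factor into `∫ exp (-a φ) ≤ C exp (-a φ(p))`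
for every point `p` (`TwoForm.HasExpBound.exists_le`). An admissible function on the product
restricts to an admissible function on each slice along a factor (`IsAdmissible.comp_update`). So
the variables can be integrated out one at a time, each being replaced by the coordinate of a fixed
`p` at the cost of a factor `C i`. With `p` a maximum point of `φ`, what remains is at most `∏ C i`.
-/

/-- For any linear order on the index type, a block diagonal matrix is block triangular. -/
theorem Matrix.det_blockDiagonal_sigma {ι R : Type*} [Fintype ι] [DecidableEq ι] [CommRing R]
    {m : ι → Type*} [∀ i, Fintype (m i)] [∀ i, DecidableEq (m i)]
    (A : ∀ i, Matrix (m i) (m i) R) :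
    (Matrix.blockDiagonal' A).det = ∏ i, (A i).det := by
  let _ : LinearOrder ι := LinearOrder.lift' (Fintype.equivFin ι) (Fintype.equivFin ι).injective
  have h : (Matrix.blockDiagonal' A).BlockTriangular Sigma.fst := by
    rintro ⟨i, k⟩ ⟨j, l⟩ hij
    exact Matrix.blockDiagonal'_apply_ne _ _ _ (ne_of_gt hij)
  rw [h.det_fintype]
  refine Finset.prod_congr rfl fun i _ => ?_
  rw [← Matrix.det_reindex_self (Equiv.sigmaSubtype i)]
  congr 1
  ext k l
  simp [Matrix.toSquareBlock_def, Equiv.sigmaSubtype]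

variable {E : Type*} [NormedAddCommGroup E] [NormedSpace ℂ E]

theorem alternating_two_add_left (W : E [⋀^Fin 2]→L[ℝ] ℝ) (v v' w : E) :
    W ![v + v', w] = W ![v, w] + W ![v', w] := by
  have h (c : E) : Function.update ![0, w] 0 c = ![c, w] := by ext k; fin_cases k <;> rfl
  simpa only [h] using! W.toMultilinearMap.map_update_add ![0, w] 0 v v'

theorem alternating_two_smul_left (W : E [⋀^Fin 2]→L[ℝ] ℝ) (r : ℝ) (v w : E) :
    W ![r • v, w] = r • W ![v, w] := by
  have h (c : E) : Function.update ![0, w] 0 c = ![c, w] := by ext k; fin_cases k <;> rfl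
  simpa only [h] using! W.toMultilinearMap.map_update_smul ![0, w] 0 r v

theorem alternating_two_swap (W : E [⋀^Fin 2]→L[ℝ] ℝ) (v w : E) :
    W ![v, w] = -W ![w, v] := by
  have h : ![w, v] ∘ Equiv.swap 0 1 = ![v, w] := by ext k; fin_cases k <;> rfl
  simpa only [h] using! W.toAlternatingMap.map_swap ![w, v] (show (0 : Fin 2) ≠ 1 by decide)

theorem alternating_two_add_right (W : E [⋀^Fin 2]→L[ℝ] ℝ) (v w w' : E) :
    W ![v, w + w'] = W ![v, w] + W ![v, w'] := by
  rw [alternating_two_swap, alternating_two_add_left, alternating_two_swap W v w,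
    alternating_two_swap W v w', neg_add]

theorem alternating_two_smul_right (W : E [⋀^Fin 2]→L[ℝ] ℝ) (r : ℝ) (v w : E) :
    W ![v, r • w] = r • W ![v, w] := by
  rw [alternating_two_swap, alternating_two_smul_left, alternating_two_swap W v w, smul_neg]

/-- The bilinear form `(v, w) ↦ W(v, J w)` attached to an alternating 2-form `W`. -/
def metricForm (W : E [⋀^Fin 2]→L[ℝ] ℝ) : LinearMap.BilinForm ℝ E :=
  LinearMap.mk₂ ℝ (fun v w => W ![v, Complex.I • w])
    (fun v v' w => alternating_two_add_left W v v' _)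
    (fun c v w => alternating_two_smul_left W c v _)
    (fun v w w' => by rw [smul_add, alternating_two_add_right])
    (fun c v w => by rw [smul_comm, alternating_two_smul_right])

@[simp]
theorem metricForm_apply (W : E [⋀^Fin 2]→L[ℝ] ℝ) (v w : E) :
    metricForm W v w = W ![v, Complex.I • w] := rfl

theorem metricForm_comp (W : E [⋀^Fin 2]→L[ℝ] ℝ) (L : E →L[ℝ] E)
    (hL : ∀ v, L (Complex.I • v) = Complex.I • L v) :
    metricForm (W.compContinuousLinearMap L) = (metricForm W).comp L L := by
  ext v w
  simp only [metricForm_apply, LinearMap.BilinForm.comp_apply,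
    ContinuousAlternatingMap.compContinuousLinearMap_apply, ContinuousLinearMap.coe_coe, ← hL]
  congr 1
  ext k
  fin_cases k <;> rfl

theorem metricForm_det_pos {κ : Type*} [Fintype κ] [DecidableEq κ] (b : Module.Basis κ ℝ E)
    (W : E [⋀^Fin 2]→L[ℝ] ℝ)
    (hJ : ∀ v w, W ![Complex.I • v, Complex.I • w] = W ![v, w])
    (hpos : ∀ v, v ≠ 0 → 0 < W ![v, Complex.I • v]) :
    0 < (LinearMap.BilinForm.toMatrix b (metricForm W)).det := by
  -- J-invariance gives `W(v, Jw) = W(Jv, JJw) = -W(Jv, w) = W(w, Jv)`.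
  have hsymm : ∀ v w, metricForm W v w = metricForm W w v := fun v w => by
    have h : (-1 : ℝ) • w = Complex.I • Complex.I • w := by simp [smul_smul]
    rw [metricForm_apply, metricForm_apply, ← hJ v, ← h, alternating_two_smul_right,
      alternating_two_swap W w, neg_one_smul]
  refine (Matrix.PosDef.of_dotProduct_mulVec_pos (Matrix.IsHermitian.ext fun i j => ?_)
    fun x hx => ?_).det_pos
  · simp only [LinearMap.BilinForm.toMatrix_apply, star_trivial]
    exact hsymm _ _
  · rw [star_trivial, LinearMap.BilinForm.dotProduct_toMatrix_mulVec]
    exact hpos _ (b.equivFun.symm.map_ne_zero_iff.2 hx)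

/-- The measure with density `√(det B)` does not depend on the basis. -/
theorem withDensity_sqrt_det_addHaar {F : Type*} [NormedAddCommGroup F] [NormedSpace ℝ F]
    [MeasurableSpace F] [BorelSpace F]
    {κ κ' : Type*} [Fintype κ] [DecidableEq κ] [Fintype κ'] [DecidableEq κ']
    (b : Module.Basis κ ℝ F) (b' : Module.Basis κ' ℝ F) (B : F → LinearMap.BilinForm ℝ F) :
    b.addHaar.withDensity
        (fun z => ENNReal.ofReal √(LinearMap.BilinForm.toMatrix b (B z)).det) =
      b'.addHaar.withDensity
        (fun z => ENNReal.ofReal √(LinearMap.BilinForm.toMatrix b' (B z)).det) := by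
  have : FiniteDimensional ℝ F := b.finiteDimensional_of_finite
  let σ : κ' ≃ κ := b'.indexEquiv b
  have hdet : ∀ z, (LinearMap.BilinForm.toMatrix b' (B z)).det =
      (LinearMap.BilinForm.toMatrix (b'.reindex σ) (B z)).det := fun z => by
    rw [← Matrix.det_reindex_self σ]
    congr 1
    ext i j
    simp
  simp only [hdet]
  rw [← b'.addHaar_reindex σ]
  generalize b'.reindex σ = c
  have h1 : b.addHaar = ENNReal.ofReal |b.det c| • c.addHaar := by
    conv_lhs => rw [Measure.addHaarMeasure_unique b.addHaar c.parallelepiped]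
    rw [Module.Basis.coe_parallelepiped, Measure.addHaar_parallelepiped, ← c.addHaar_def]
  -- Passing from `c` to `b` scales Haar measure by `|b.det c|`, and `det B` in `c` is `(b.det c)²`
  -- times `det B` in `b`; the square root cancels the factor.
  rw [h1, withDensity_smul_measure, ← withDensity_smul' _ _ ENNReal.ofReal_ne_top]
  congr 1
  ext z
  rw [Pi.smul_apply, smul_eq_mul,
    ← LinearMap.BilinForm.toMatrix_mul_basis_toMatrix (b := b) c (B z),
    ← ENNReal.ofReal_mul (abs_nonneg _), Module.Basis.det_apply, Matrix.det_mul,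
    Matrix.det_mul, Matrix.det_transpose, mul_right_comm, ← sq,
    Real.sqrt_mul (sq_nonneg _), Real.sqrt_sq_eq_abs]

end LinearAlgebra

/-! ### Fubini for product integrands, densities and Haar measures -/

section Measure

theorem lmarginal_prod {ι : Type*} {X : ι → Type*} [∀ i, MeasurableSpace (X i)]
    (μ : ∀ i, Measure (X i)) [∀ i, SigmaFinite (μ i)] [DecidableEq ι] {f : ∀ i, X i → ℝ≥0∞}
    (hf : ∀ i, Measurable (f i)) (s : Finset ι) (x : ∀ i, X i) :
    lmarginal μ s (fun x => ∏ i ∈ s, f i (x i)) x = ∏ i ∈ s, ∫⁻ t, f i t ∂μ i := by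
  induction s using Finset.induction_on generalizing x with
  | empty => simp
  | insert i s hi ih =>
    have hm : ∀ s : Finset ι, Measurable fun x : ∀ i, X i => ∏ i ∈ s, f i (x i) := fun s =>
      Finset.measurable_fun_prod _ fun i _ => (hf i).comp (measurable_pi_apply i)
    rw [lmarginal_insert' _ (hm _) hi, Finset.prod_insert hi, ← ih x]
    have : (fun x : ∀ i, X i =>
        ∫⁻ t, ∏ j ∈ insert i s, f j (Function.update x i t j) ∂μ i) =
        fun x => (∫⁻ t, f i t ∂μ i) * ∏ j ∈ s, f j (x j) := by
      ext x
      rw [← lintegral_mul_const _ (hf i)]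
      refine lintegral_congr fun t => ?_
      rw [Finset.prod_insert hi, Function.update_self]
      congr 1
      refine Finset.prod_congr rfl fun j hj => ?_
      rw [Function.update_of_ne (ne_of_mem_of_not_mem hj hi)]
    rw [this]
    exact lintegral_const_mul _ ((hm s).comp measurable_updateFinset)

variable {ι : Type*} [Fintype ι] {X : ι → Type*} [∀ i, MeasurableSpace (X i)]
  (μ : ∀ i, Measure (X i))

theorem lintegral_pi_prod [∀ i, SigmaFinite (μ i)] {f : ∀ i, X i → ℝ≥0∞}
    (hf : ∀ i, Measurable (f i)) :
    ∫⁻ x, ∏ i, f i (x i) ∂Measure.pi μ = ∏ i, ∫⁻ t, f i t ∂μ i := by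
  classical
  by_cases h : Nonempty (∀ i, X i)
  · obtain ⟨x⟩ := h
    rw [lintegral_eq_lmarginal_univ x, lmarginal_prod μ hf]
  -- Without a base point `lmarginal` is unavailable, but both sides vanish.
  · obtain ⟨i, hi⟩ : ∃ i, IsEmpty (X i) := by simpa using h
    have : IsEmpty (∀ i, X i) := not_nonempty_iff.1 h
    rw [Finset.prod_eq_zero (Finset.mem_univ i), lintegral_of_isEmpty]
    exact lintegral_of_isEmpty _ _

theorem pi_withDensity [∀ i, SigmaFinite (μ i)] {f : ∀ i, X i → ℝ≥0∞}
    (hf : ∀ i, Measurable (f i)) (hf' : ∀ i x, f i x ≠ ⊤) :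
    Measure.pi (fun i => (μ i).withDensity (f i)) =
      (Measure.pi μ).withDensity fun x => ∏ i, f i (x i) := by
  classical
  have (i : ι) : SigmaFinite ((μ i).withDensity (f i)) :=
    SigmaFinite.withDensity_of_ne_top' (hf' i)
  refine Measure.pi_eq fun s hs => ?_
  rw [withDensity_apply _ (MeasurableSet.univ_pi hs), ← lintegral_indicator (.univ_pi hs)]
  have : (Set.univ.pi s).indicator (fun x => ∏ i, f i (x i)) =
      fun x => ∏ i, (s i).indicator (f i) (x i) := by
    ext x
    by_cases hx : x ∈ Set.univ.pi s
    · rw [Set.indicator_of_mem hx]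
      exact Finset.prod_congr rfl fun i _ => (Set.indicator_of_mem (hx i trivial) _).symm
    · rw [Set.indicator_of_notMem hx]
      obtain ⟨i, hi⟩ : ∃ i, x i ∉ s i := by simpa using hx
      exact (Finset.prod_eq_zero (Finset.mem_univ i) (Set.indicator_of_notMem hi _)).symm
  rw [this, lintegral_pi_prod μ fun i => (hf i).indicator (hs i)]
  refine Finset.prod_congr rfl fun i _ => ?_
  rw [withDensity_apply _ (hs i), lintegral_indicator (hs i)]

theorem parallelepiped_pi_basis {F : ι → Type*} [∀ i, AddCommGroup (F i)]
    [∀ i, Module ℝ (F i)] {κ : ι → Type*} [∀ i, Fintype (κ i)]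
    (b : ∀ i, Module.Basis (κ i) ℝ (F i)) :
    parallelepiped (Pi.basis b) = Set.univ.pi fun i => parallelepiped (b i) := by
  ext x
  rw [Set.mem_univ_pi, parallelepiped_basis_eq]
  simp only [parallelepiped_basis_eq, Set.mem_ofPred_eq, Pi.basis_repr, Sigma.forall]

theorem addHaar_pi_basis {F : ι → Type*} [∀ i, NormedAddCommGroup (F i)]
    [∀ i, NormedSpace ℝ (F i)] [∀ i, MeasurableSpace (F i)] [∀ i, BorelSpace (F i)]
    [∀ i, SecondCountableTopology (F i)]
    {κ : ι → Type*} [∀ i, Fintype (κ i)] (b : ∀ i, Module.Basis (κ i) ℝ (F i)) :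
    (Pi.basis b).addHaar = Measure.pi fun i => (b i).addHaar := by
  classical
  rw [Module.Basis.addHaar_eq_iff, Module.Basis.coe_parallelepiped, parallelepiped_pi_basis,
    Measure.pi_pi]
  simp [Module.Basis.addHaar_self]

end Measure

/-! ### Forms and metric densities under holomorphic changes of chart -/

section Charts

variable {E M : Type*} [NormedAddCommGroup E] [NormedSpace ℂ E] [TopologicalSpace M]
  [ChartedSpace E M]

theorem differentiableAt_chart_transition [IsManifold 𝓘(ℂ, E) ω M]
    {e e' : OpenPartialHomeomorph M E} (he : e ∈ atlas E M) (he' : e' ∈ atlas E M) {z : E}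
    (hz : z ∈ e.target) (hz' : e.symm z ∈ e'.source) :
    DifferentiableAt ℂ (e' ∘ e.symm) z := by
  have h := (contDiffGroupoid ω 𝓘(ℂ, E)).compatible he he'
  have h1 : ContDiffOn ℂ ω (e' ∘ e.symm) (e.symm.trans e').source := by
    have := (contDiffGroupoid ω 𝓘(ℂ, E)).mem_of_eqOnSource h (Setoid.refl _)
    rw [contDiffGroupoid, mem_groupoid_of_pregroupoid] at this
    simpa [contDiffPregroupoid] using this.1
  have hmem : z ∈ (e.symm.trans e').source := by simp [hz, hz']
  exact (h1.contDiffAt ((e.symm.trans e').open_source.mem_nhds hmem)).differentiableAt (by simp)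

theorem fderiv_real_smul_I {F : Type*} [NormedAddCommGroup F] [NormedSpace ℂ F] {f : E → F} {z : E}
    (hf : DifferentiableAt ℂ f z) (v : E) :
    fderiv ℝ f z (Complex.I • v) = Complex.I • fderiv ℝ f z v := by
  rw [(hf.hasFDerivAt.restrictScalars ℝ).fderiv]
  simp

theorem TwoForm.inChart_transition [IsManifold 𝓘(ℂ, E) ω M] (Ω : TwoForm E M)
    {e e' : OpenPartialHomeomorph M E} (he : e ∈ atlas E M) (he' : e' ∈ atlas E M) {z : E}
    (hz : z ∈ e.target) (hz' : e.symm z ∈ e'.source) :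
    Ω.inChart e z =
      (Ω.inChart e' (e' (e.symm z))).compContinuousLinearMap (fderiv ℝ (e' ∘ e.symm) z) := by
  have hx : e'.symm (e' (e.symm z)) = e.symm z := e'.left_inv hz'
  have hd : fderiv ℝ (chartAt E (e.symm z) ∘ e.symm) z =
      (fderiv ℝ (chartAt E (e.symm z) ∘ e'.symm) (e' (e.symm z))).comp
        (fderiv ℝ (e' ∘ e.symm) z) := by
    have h1 : DifferentiableAt ℝ (chartAt E (e.symm z) ∘ e'.symm) ((e' ∘ e.symm) z) := by
      refine (differentiableAt_chart_transition he' (chart_mem_atlas E _)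
        (e'.map_source hz') ?_).restrictScalars ℝ
      simp only [hx, mem_chart_source]
    refine Eq.trans ?_ (fderiv_comp z h1
      ((differentiableAt_chart_transition he he' hz hz').restrictScalars ℝ))
    refine Filter.EventuallyEq.fderiv_eq ?_
    filter_upwards [(e.symm.trans e').open_source.mem_nhds
      (show z ∈ (e.symm.trans e').source by simp [hz, hz'])] with y hy
    have hy' : e.symm y ∈ e'.source := by simpa using hy.2
    simp only [Function.comp_apply, e'.left_inv hy']
  simp only [TwoForm.inChart, hx, hd]
  rfl

theorem TwoForm.inChart_chartAt (Ω : TwoForm E M) (x : M) :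
    Ω.inChart (chartAt E x) (chartAt E x x) = Ω x := by
  have hx : (chartAt E x).symm (chartAt E x x) = x := (chartAt E x).left_inv (mem_chart_source E x)
  have hd : fderiv ℝ (chartAt E x ∘ (chartAt E x).symm) (chartAt E x x) =
      ContinuousLinearMap.id ℝ E := by
    rw [← fderiv_id (𝕜 := ℝ) (x := chartAt E x x)]
    refine Filter.EventuallyEq.fderiv_eq ?_
    filter_upwards [(chartAt E x).open_target.mem_nhds (mem_chart_target E x)] with y hy
    simp [(chartAt E x).right_inv hy]
  simp only [TwoForm.inChart, hx, hd]
  rfl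

variable [FiniteDimensional ℂ E]

theorem TwoForm.density_eq (Ω : TwoForm E M) (e : OpenPartialHomeomorph M E) (z : E) :
    Ω.density e z =
      √(LinearMap.BilinForm.toMatrix (Module.finBasis ℝ E) (metricForm (Ω.inChart e z))).det := by
  rw [TwoForm.density]
  congr 2
  ext i j
  simp

/-- The transition derivative is complex linear, so it pulls back the metric `W(v, Jw)` and not
merely `W`; the Gram determinant then acquires the squared real Jacobian. -/
theorem TwoForm.density_transition [IsManifold 𝓘(ℂ, E) ω M] (Ω : TwoForm E M)
    {e e' : OpenPartialHomeomorph M E} (he : e ∈ atlas E M) (he' : e' ∈ atlas E M) {z : E}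
    (hz : z ∈ e.target) (hz' : e.symm z ∈ e'.source) :
    Ω.density e z = |(fderiv ℝ (e' ∘ e.symm) z).det| * Ω.density e' (e' (e.symm z)) := by
  rw [Ω.density_eq, Ω.density_eq, Ω.inChart_transition he he' hz hz', metricForm_comp _ _
    (fderiv_real_smul_I (differentiableAt_chart_transition he he' hz hz')),
    LinearMap.BilinForm.toMatrix_comp (Module.finBasis ℝ E), Matrix.det_mul, Matrix.det_mul,
    Matrix.det_transpose, LinearMap.det_toMatrix, mul_right_comm, ← sq,
    Real.sqrt_mul (sq_nonneg _), Real.sqrt_sq_eq_abs]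

theorem IsKahlerForm.continuousOn_density {Ω : TwoForm E M} (hΩ : IsKahlerForm Ω)
    {e : OpenPartialHomeomorph M E} (he : e ∈ atlas E M) :
    ContinuousOn (Ω.density e) e.target := by
  have h := (hΩ.smooth e he).continuousOn
  refine Real.continuous_sqrt.comp_continuousOn ?_
  refine (Continuous.matrix_det continuous_id).comp_continuousOn ?_
  refine continuousOn_pi.2 fun i => continuousOn_pi.2 fun j => ?_
  exact (ContinuousEvalConst.continuous_eval_const _).comp_continuousOn h

-- Positivity is assumed only in preferred charts; a general chart changes the determinant by a
-- square. This sign lets the square root be split over factors.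
omit [FiniteDimensional ℂ E] in
theorem IsKahlerForm.metricForm_inChart_det_nonneg [IsManifold 𝓘(ℂ, E) ω M] {Ω : TwoForm E M}
    (hΩ : IsKahlerForm Ω) {κ : Type*} [Fintype κ] [DecidableEq κ] (b : Module.Basis κ ℝ E)
    {e : OpenPartialHomeomorph M E} (he : e ∈ atlas E M) {z : E} (hz : z ∈ e.target) :
    0 ≤ (LinearMap.BilinForm.toMatrix b (metricForm (Ω.inChart e z))).det := by
  have hx := mem_chart_source E (e.symm z)
  rw [Ω.inChart_transition he (chart_mem_atlas E (e.symm z)) hz hx, Ω.inChart_chartAt,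
    metricForm_comp _ _ (fderiv_real_smul_I
      (differentiableAt_chart_transition he (chart_mem_atlas E (e.symm z)) hz hx)),
    LinearMap.BilinForm.toMatrix_comp b, Matrix.det_mul, Matrix.det_mul,
    Matrix.det_transpose, mul_right_comm, ← sq]
  exact mul_nonneg (sq_nonneg _)
    (metricForm_det_pos b _ (hΩ.type_one_one _) (hΩ.pos _)).le

theorem IsKahlerForm.density_chartAt_pos {Ω : TwoForm E M} (hΩ : IsKahlerForm Ω) (x : M) :
    0 < Ω.density (chartAt E x) (chartAt E x x) := by
  rw [Ω.density_eq, Ω.inChart_chartAt]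
  exact Real.sqrt_pos.2 (metricForm_det_pos _ _ (hΩ.type_one_one x) (hΩ.pos x))

end Charts

/-! ### Gluing the chart volumes -/

section Volume

variable {E M : Type*} [NormedAddCommGroup E] [NormedSpace ℂ E] [TopologicalSpace M]
  [ChartedSpace E M] [FiniteDimensional ℂ E] [MeasurableSpace M] [BorelSpace M]
  [MeasurableSpace E] [BorelSpace E]

omit [BorelSpace M] in
theorem TwoForm.chartVolume_eq (Ω : TwoForm E M) (e : OpenPartialHomeomorph M E) :
    Ω.chartVolume e = (((Module.finBasis ℝ E).addHaar.restrict e.target).withDensity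
      fun z => ENNReal.ofReal (Ω.density e z)).map e.symm := by
  obtain rfl := BorelSpace.measurable_eq (α := E)
  rfl

theorem OpenPartialHomeomorph.measurableSet_target_inter_symm_preimage {E M : Type*}
    [TopologicalSpace M] [MeasurableSpace M] [BorelSpace M]
    [TopologicalSpace E] [MeasurableSpace E] [BorelSpace E] (e : OpenPartialHomeomorph M E)
    {A : Set M} (hA : MeasurableSet A) : MeasurableSet (e.target ∩ e.symm ⁻¹' A) := by
  rw [← Subtype.image_preimage_coe]
  exact e.open_target.measurableSet.subtype_image
    (e.continuousOn_symm.domRestrict.measurable hA)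

theorem OpenPartialHomeomorph.aemeasurable_symm {E M : Type*}
    [TopologicalSpace M] [MeasurableSpace M] [BorelSpace M]
    [TopologicalSpace E] [MeasurableSpace E] [BorelSpace E] (e : OpenPartialHomeomorph M E)
    {μ : Measure E} : AEMeasurable e.symm (μ.restrict e.target) :=
  (aemeasurable_restrict_iff_comap_subtype e.open_target.measurableSet).2
    e.continuousOn_symm.domRestrict.measurable.aemeasurable

theorem TwoForm.chartVolume_apply (Ω : TwoForm E M) (e : OpenPartialHomeomorph M E) {A : Set M}
    (hA : MeasurableSet A) :
    Ω.chartVolume e A = ∫⁻ z in e.target ∩ e.symm ⁻¹' A,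
      ENNReal.ofReal (Ω.density e z) ∂(Module.finBasis ℝ E).addHaar := by
  have hm := e.open_target.measurableSet
  have hS := e.measurableSet_target_inter_symm_preimage hA
  rw [Ω.chartVolume_eq, Measure.map_apply_of_aemeasurable
    (e.aemeasurable_symm.mono_ac (withDensity_absolutelyContinuous _ _)) hA]
  rw [← restrict_withDensity hm, Measure.restrict_apply' hm, Set.inter_comm,
    withDensity_apply _ hS]

/-- Change of variables along the transition map: the Jacobian factor is the one in
`density_transition`. -/
theorem TwoForm.chartVolume_restrict [IsManifold 𝓘(ℂ, E) ω M] (Ω : TwoForm E M)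
    {e e' : OpenPartialHomeomorph M E} (he : e ∈ atlas E M) (he' : e' ∈ atlas E M) :
    (Ω.chartVolume e).restrict e'.source = (Ω.chartVolume e').restrict e.source := by
  ext A hA
  have hm := e.open_source.measurableSet
  have hm' := e'.open_source.measurableSet
  rw [Measure.restrict_apply hA, Measure.restrict_apply hA, Ω.chartVolume_apply _ (hA.inter hm'),
    Ω.chartVolume_apply _ (hA.inter hm)]
  set S := e.target ∩ e.symm ⁻¹' (A ∩ e'.source) with hS
  have himage : e'.target ∩ e'.symm ⁻¹' (A ∩ e.source) = (e' ∘ e.symm) '' S := by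
    ext w
    constructor
    · rintro ⟨hw, hwA, hws⟩
      refine ⟨e (e'.symm w), ⟨e.map_source hws, ?_⟩, ?_⟩
      · simpa [e.left_inv hws, hwA] using e'.map_target hw
      · simp [e.left_inv hws, e'.right_inv hw]
    · rintro ⟨z, ⟨hz, hzA, hzs⟩, rfl⟩
      refine ⟨e'.map_source hzs, ?_⟩
      simpa [e'.left_inv hzs, hzA] using e.map_target hz
  rw [himage, lintegral_image_eq_lintegral_abs_det_fderiv_mul _
    (e.measurableSet_target_inter_symm_preimage (hA.inter hm'))
    (fun z hz => ((differentiableAt_chart_transition he he' hz.1 hz.2.2).restrictScalars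
      ℝ).hasFDerivAt.hasFDerivWithinAt) ?_]
  · refine setLIntegral_congr_fun (e.measurableSet_target_inter_symm_preimage (hA.inter hm'))
      fun z hz => ?_
    simp only [Function.comp_apply]
    rw [Ω.density_transition he he' hz.1 hz.2.2, ENNReal.ofReal_mul (abs_nonneg _)]
  · intro z hz w hw h
    exact e.symm.injOn hz.1 hw.1 (e'.injOn hz.2.2 hw.2.2 h)

theorem TwoForm.chartVolume_compl_source (Ω : TwoForm E M) (e : OpenPartialHomeomorph M E) :
    Ω.chartVolume e e.sourceᶜ = 0 := by
  rw [Ω.chartVolume_apply _ e.open_source.measurableSet.compl]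
  have : e.target ∩ e.symm ⁻¹' e.sourceᶜ = ∅ := by
    ext z
    simpa using fun hz => e.map_target hz
  rw [this, Measure.restrict_empty, lintegral_zero_measure]

omit [BorelSpace M] [MeasurableSpace E] [BorelSpace E] in
theorem TwoForm.chartVolume_le_volume (Ω : TwoForm E M) {e : OpenPartialHomeomorph M E}
    (he : e ∈ atlas E M) : Ω.chartVolume e ≤ Ω.volume :=
  le_iSup₂ (f := fun e (_ : e ∈ atlas E M) => Ω.chartVolume e) e he

theorem TwoForm.volume_restrict_source [IsManifold 𝓘(ℂ, E) ω M] (Ω : TwoForm E M)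
    {e : OpenPartialHomeomorph M E} (he : e ∈ atlas E M) :
    Ω.volume.restrict e.source = Ω.chartVolume e := by
  have hm := e.open_source.measurableSet
  have hr : (Ω.chartVolume e).restrict e.source = Ω.chartVolume e :=
    Measure.restrict_eq_self_of_ae_mem (Ω.chartVolume_compl_source e)
  refine le_antisymm ?_ ?_
  -- A supremum of measures is bounded by any common upper bound. This one is sharp on `e.source`
  -- and infinite on nonempty sets outside it, so only overlaps matter.
  · have h : Ω.volume ≤ Ω.chartVolume e + (⊤ : Measure M).restrict e.sourceᶜ := by
      refine iSup₂_le fun e' he' => ?_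
      rw [← Measure.restrict_add_restrict_compl (μ := Ω.chartVolume e') hm,
        ← Ω.chartVolume_restrict he he']
      exact add_le_add Measure.restrict_le_self (Measure.restrict_mono le_rfl le_top)
    refine (Measure.restrict_mono le_rfl h).trans ?_
    rw [Measure.restrict_add, hr, Measure.restrict_restrict hm]
    simp
  · rw [← hr]
    exact Measure.restrict_mono le_rfl (Ω.chartVolume_le_volume he)

end Volume

/-! ### The total volume is finite and nonzero -/

section FiniteVolume

variable {E M : Type*} [NormedAddCommGroup E] [NormedSpace ℂ E] [TopologicalSpace M]
  [ChartedSpace E M] [FiniteDimensional ℂ E] [MeasurableSpace M] [BorelSpace M]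
  {Ω : TwoForm E M}

theorem IsKahlerForm.isFiniteMeasure_volume [IsManifold 𝓘(ℂ, E) ω M] [CompactSpace M]
    (hΩ : IsKahlerForm Ω) : IsFiniteMeasure Ω.volume := by
  borelize E
  suffices IsLocallyFiniteMeasure Ω.volume from
    ⟨isCompact_univ.measure_lt_top⟩
  refine ⟨fun x => ?_⟩
  set e := chartAt E x
  have he : e ∈ atlas E M := chart_mem_atlas E x
  have : ProperSpace E := FiniteDimensional.proper_real E
  obtain ⟨r, hr, hball⟩ := Metric.nhds_basis_closedBall.mem_iff.1
    (e.open_target.mem_nhds (mem_chart_target E x))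
  have hU : IsOpen (e.source ∩ e ⁻¹' Metric.ball (e x) r) :=
    e.isOpen_inter_preimage Metric.isOpen_ball
  refine ⟨_, hU.mem_nhds ⟨mem_chart_source E x, Metric.mem_ball_self hr⟩, ?_⟩
  rw [← Measure.restrict_eq_self _ Set.inter_subset_left, Ω.volume_restrict_source he,
    Ω.chartVolume_apply _ hU.measurableSet]
  refine (lintegral_mono_set (t := Metric.closedBall (e x) r) ?_).trans_lt ?_
  · rintro z ⟨hz, -, hz'⟩
    rw [Set.mem_preimage, e.right_inv hz] at hz'
    exact Metric.ball_subset_closedBall hz'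
  · exact (((hΩ.continuousOn_density he).mono hball).integrableOn_compact
      (isCompact_closedBall _ _)).lintegral_lt_top

theorem IsKahlerForm.volume_univ_ne_zero [Nonempty M] (hΩ : IsKahlerForm Ω) :
    Ω.volume Set.univ ≠ 0 := by
  borelize E
  obtain ⟨x⟩ := ‹Nonempty M›
  set e := chartAt E x
  have he : e ∈ atlas E M := chart_mem_atlas E x
  intro h
  have h0 : Ω.chartVolume e Set.univ = 0 := le_zero_iff.1 (h ▸ Ω.chartVolume_le_volume he _)
  rw [Ω.chartVolume_apply _ MeasurableSet.univ, Set.preimage_univ, Set.inter_univ] at h0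
  -- The density is positive at the centre of the preferred chart, hence on an open set, which Haar
  -- measure charges.
  set U := e.target ∩ Ω.density e ⁻¹' Set.Ioi 0 with hUdef
  have hU : IsOpen U := (hΩ.continuousOn_density he).isOpen_inter_preimage e.open_target isOpen_Ioi
  have hpos := hU.measure_pos (Module.finBasis ℝ E).addHaar
    ⟨e x, mem_chart_target E x, hΩ.density_chartAt_pos x⟩
  have hm := e.open_target.measurableSet
  have hae := (setLIntegral_eq_zero_iff' hm
    ((hΩ.continuousOn_density he).aemeasurable hm).ennreal_ofReal).1 h0
  refine hpos.ne' (measure_mono_null (fun z hz => ?_) hae)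
  simpa using ⟨hz.1, hz.2⟩

end FiniteVolume

/-! ### The product metric has the product volume -/

section ProductVolume

variable {ι : Type*} [Fintype ι] {E M : ι → Type*} [∀ i, NormedAddCommGroup (E i)]
  [∀ i, NormedSpace ℂ (E i)] [∀ i, TopologicalSpace (M i)] [∀ i, ChartedSpace (E i) (M i)]

theorem TwoForm.inChart_directSum [∀ i, IsManifold 𝓘(ℂ, E i) ω (M i)]
    (Ω : ∀ i, TwoForm (E i) (M i)) {e : ∀ i, OpenPartialHomeomorph (M i) (E i)}
    (he : ∀ i, e i ∈ atlas (E i) (M i)) {z : ∀ i, E i} (hz : ∀ i, z i ∈ (e i).target) :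
    (TwoForm.directSum Ω).inChart (OpenPartialHomeomorph.pi e) z =
      ∑ i, ((Ω i).inChart (e i) (z i)).compContinuousLinearMap (ContinuousLinearMap.proj i) := by
  have hd : HasFDerivAt (𝕜 := ℝ)
      (chartAt (∀ i, E i) ((OpenPartialHomeomorph.pi e).symm z) ∘ (OpenPartialHomeomorph.pi e).symm)
      (ContinuousLinearMap.pi fun i =>
        (fderiv ℝ (chartAt (E i) ((e i).symm (z i)) ∘ (e i).symm) (z i)).comp
          (ContinuousLinearMap.proj i)) z := by
    refine hasFDerivAt_pi.2 fun i => ?_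
    have h1 := ((differentiableAt_chart_transition (he i) (chart_mem_atlas (E i) _) (hz i)
      (mem_chart_source (E i) ((e i).symm (z i)))).restrictScalars ℝ).hasFDerivAt
    exact h1.comp z (ContinuousLinearMap.proj (R := ℝ) (φ := E) i).hasFDerivAt
  rw [TwoForm.inChart, hd.fderiv]
  ext v
  simp [TwoForm.directSum, TwoForm.inChart]
  rfl

theorem metricForm_sum_proj_det {κ : ι → Type*} [∀ i, Fintype (κ i)] [∀ i, DecidableEq (κ i)]
    [DecidableEq ι] (b : ∀ i, Module.Basis (κ i) ℝ (E i)) (W : ∀ i, E i [⋀^Fin 2]→L[ℝ] ℝ) :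
    (LinearMap.BilinForm.toMatrix (Pi.basis b) (metricForm
      (∑ i, (W i).compContinuousLinearMap (ContinuousLinearMap.proj i)))).det =
    ∏ i, (LinearMap.BilinForm.toMatrix (b i) (metricForm (W i))).det := by
  rw [← Matrix.det_blockDiagonal_sigma]
  congr 1
  ext ⟨i, k⟩ ⟨j, l⟩
  have hzero (m : ι) (v w : E m) (h : v = 0 ∨ w = 0) : W m ![v, w] = 0 := by
    rcases h with rfl | rfl
    · exact (W m).map_coord_zero 0 rfl
    · exact (W m).map_coord_zero 1 rfl
  have happ : LinearMap.BilinForm.toMatrix (Pi.basis b) (metricForm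
      (∑ i, (W i).compContinuousLinearMap (ContinuousLinearMap.proj i))) ⟨i, k⟩ ⟨j, l⟩ =
      ∑ m, W m ![Pi.single (M := E) i (b i k) m,
        Complex.I • Pi.single (M := E) j (b j l) m] := by
    simp only [LinearMap.BilinForm.toMatrix_apply, metricForm_apply,
      ContinuousAlternatingMap.sum_apply, Pi.basis_apply]
    refine Finset.sum_congr rfl fun m _ => ?_
    rw [ContinuousAlternatingMap.compContinuousLinearMap_apply]
    congr 1
    ext n
    fin_cases n <;> rfl
  rw [happ, Finset.sum_eq_single i]
  · by_cases hij : i = j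
    · subst hij
      simp
    · rw [Matrix.blockDiagonal'_apply_ne _ _ _ hij]
      refine hzero _ _ _ (.inr ?_)
      rw [Pi.single_eq_of_ne hij, smul_zero]
  · intro m _ hm
    exact hzero _ _ _ (.inl (Pi.single_eq_of_ne hm _))
  · simp

variable [∀ i, FiniteDimensional ℂ (E i)]

theorem TwoForm.chartVolume_directSum [∀ i, IsManifold 𝓘(ℂ, E i) ω (M i)]
    [∀ i, MeasurableSpace (M i)] [∀ i, BorelSpace (M i)]
    {Ω : ∀ i, TwoForm (E i) (M i)} (hΩ : ∀ i, IsKahlerForm (Ω i))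
    {e : ∀ i, OpenPartialHomeomorph (M i) (E i)} (he : ∀ i, e i ∈ atlas (E i) (M i))
    [∀ i, SigmaFinite ((Ω i).chartVolume (e i))] :
    (TwoForm.directSum Ω).chartVolume (OpenPartialHomeomorph.pi e) =
      Measure.pi fun i => (Ω i).chartVolume (e i) := by
  classical
  let _ : ∀ i, MeasurableSpace (E i) := fun i => borel (E i)
  have _ : ∀ i, BorelSpace (E i) := fun i => ⟨rfl⟩
  have (i : ι) : ProperSpace (E i) := FiniteDimensional.proper_real (E i)
  -- Extension by zero makes the density globally measurable.
  let f : ∀ i, E i → ℝ≥0∞ := fun i =>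
    (e i).target.indicator fun z => ENNReal.ofReal ((Ω i).density (e i) z)
  have hm (i : ι) : MeasurableSet (e i).target := (e i).open_target.measurableSet
  have hf (i : ι) : Measurable (f i) := by
    have h := ContinuousOn.measurable_piecewise
      (ENNReal.continuous_ofReal.comp_continuousOn ((hΩ i).continuousOn_density (he i)))
      (continuous_zero.continuousOn (s := ((e i).target)ᶜ)) (hm i)
    rwa [Set.piecewise_eq_indicator] at h
  have hfac (i : ι) : (Ω i).chartVolume (e i) =
      ((Module.finBasis ℝ (E i)).addHaar.withDensity (f i)).map (e i).symm := by
    rw [TwoForm.chartVolume_eq, withDensity_indicator (hm i)]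
  have hsigma (i : ι) : SigmaFinite
      (((Module.finBasis ℝ (E i)).addHaar.withDensity (f i)).map (e i).symm) := by
    rw [← hfac]; infer_instance
  have hae (i : ι) : AEMeasurable (e i).symm
      ((Module.finBasis ℝ (E i)).addHaar.withDensity (f i)) := by
    rw [withDensity_indicator (hm i)]
    exact (e i).aemeasurable_symm.mono_ac (withDensity_absolutelyContinuous _ _)
  have hT : (OpenPartialHomeomorph.pi e).target = Set.univ.pi fun i => (e i).target := rfl
  have hmT : MeasurableSet (Set.univ.pi fun i => (e i).target) := MeasurableSet.univ_pi hm
  simp only [hfac]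
  have (i : ι) : SigmaFinite ((Module.finBasis ℝ (E i)).addHaar.withDensity (f i)) :=
    (hsigma i).of_map _ (hae i)
  rw [← Measure.pi_map_pi hae, pi_withDensity _ hf, ← addHaar_pi_basis, TwoForm.chartVolume_eq, hT]
  · congr 1
    simp only [TwoForm.density_eq]
    -- The chosen basis of the product space need not be assembled from those of the factors; basis
    -- independence permits the switch, after which the Gram matrix is block diagonal.
    rw [← restrict_withDensity hmT, withDensity_sqrt_det_addHaar _
      (Pi.basis fun i => Module.finBasis ℝ (E i)), restrict_withDensity hmT,
      ← withDensity_indicator hmT]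
    congr 1
    ext z
    by_cases hz : z ∈ Set.univ.pi fun i => (e i).target
    · rw [Set.indicator_of_mem hz, TwoForm.inChart_directSum Ω he fun i => hz i trivial,
        metricForm_sum_proj_det, Real.sqrt_prod _ fun i _ =>
          (hΩ i).metricForm_inChart_det_nonneg _ (he i) (hz i trivial),
        ENNReal.ofReal_prod_of_nonneg fun _ _ => Real.sqrt_nonneg _]
      refine Finset.prod_congr rfl fun i _ => ?_
      rw [← TwoForm.density_eq]
      simp only [f, Set.indicator_of_mem (hz i trivial)]
    · rw [Set.indicator_of_notMem hz]
      obtain ⟨i, hi⟩ : ∃ i, z i ∉ (e i).target := by simpa using hz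
      exact (Finset.prod_eq_zero (Finset.mem_univ i) (Set.indicator_of_notMem hi _)).symm
  · intro i x
    by_cases hx : x ∈ (e i).target <;> simp [f, hx]

theorem TwoForm.volume_directSum [∀ i, IsManifold 𝓘(ℂ, E i) ω (M i)] [∀ i, CompactSpace (M i)]
    [∀ i, MeasurableSpace (M i)] [∀ i, BorelSpace (M i)]
    {Ω : ∀ i, TwoForm (E i) (M i)} (hΩ : ∀ i, IsKahlerForm (Ω i)) :
    (TwoForm.directSum Ω).volume = Measure.pi fun i => (Ω i).volume := by
  have _ (i : ι) : IsFiniteMeasure (Ω i).volume := (hΩ i).isFiniteMeasure_volume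
  let _ : ∀ i, MeasurableSpace (E i) := fun i => borel (E i)
  have _ : ∀ i, BorelSpace (E i) := fun i => ⟨rfl⟩
  have key {e : ∀ i, OpenPartialHomeomorph (M i) (E i)} (he : ∀ i, e i ∈ atlas (E i) (M i)) :
      (TwoForm.directSum Ω).chartVolume (OpenPartialHomeomorph.pi e) =
        (Measure.pi fun i => (Ω i).volume).restrict (Set.univ.pi fun i => (e i).source) := by
    have h (i : ι) := (Ω i).volume_restrict_source (he i)
    have _ (i : ι) : SigmaFinite ((Ω i).chartVolume (e i)) := by
      rw [← h i]; infer_instance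
    rw [TwoForm.chartVolume_directSum hΩ he, Measure.restrict_pi_pi]
    simp only [h]
  have hle : (TwoForm.directSum Ω).volume ≤ Measure.pi fun i => (Ω i).volume := by
    refine iSup₂_le fun e he => ?_
    obtain ⟨e, he, rfl⟩ := he
    rw [key fun i => he i trivial]
    exact Measure.restrict_le_self
  -- Compactness gives a countable cover by product charts, so the reverse inequality is needed only
  -- on each chart.
  obtain ⟨s, hs, hcover⟩ := countable_cover_nhds_of_sigmaCompact fun x : ∀ i, M i =>
    chart_source_mem_nhds (∀ i, E i) x
  have _ : Countable s := hs
  rw [Set.biUnion_eq_iUnion] at hcover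
  refine Measure.ext_of_iUnion_eq_univ hcover fun x => ?_
  have hx := key fun i => chart_mem_atlas (E i) (x.1 i)
  have hm : MeasurableSet (Set.univ.pi fun i => (chartAt (E i) (x.1 i)).source) :=
    MeasurableSet.univ_pi fun i => (chartAt (E i) (x.1 i)).open_source.measurableSet
  have hsource : (chartAt (∀ i, E i) x.1).source =
    Set.univ.pi fun i => (chartAt (E i) (x.1 i)).source := rfl
  rw [hsource]
  refine le_antisymm (Measure.restrict_mono le_rfl hle) ?_
  have hself : (Measure.pi fun i => (Ω i).volume).restrict
      (Set.univ.pi fun i => (chartAt (E i) (x.1 i)).source) =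
      ((TwoForm.directSum Ω).chartVolume (chartAt (∀ i, E i) x.1)).restrict
        (Set.univ.pi fun i => (chartAt (E i) (x.1 i)).source) := by
    refine Eq.trans ?_ (congrArg (Measure.restrict · _) hx.symm)
    rw [Measure.restrict_restrict hm, Set.inter_self]
  rw [hself]
  exact Measure.restrict_mono le_rfl (TwoForm.chartVolume_le_volume _ (chart_mem_atlas _ _))

end ProductVolume

/-! ### Second derivatives along affine maps -/

section Smooth

theorem contMDiff_real_iff {F N : Type*} [NormedAddCommGroup F] [NormedSpace ℝ F]
    [TopologicalSpace N] [ChartedSpace F N] {φ : N → ℝ} :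
    ContMDiff 𝓘(ℝ, F) 𝓘(ℝ, ℝ) ∞ φ ↔
      Continuous φ ∧ ∀ x, ContDiffAt ℝ ∞ (φ ∘ (chartAt F x).symm) (chartAt F x x) := by
  simp only [ContMDiff, contMDiffAt_iff, forall_and, continuous_iff_continuousAt]
  simp only [extChartAt_model_space_eq_id, PartialEquiv.refl_coe, Function.id_comp,
    modelWithCornersSelf_coe, Set.range_id, contDiffWithinAt_univ]
  rfl

/-- As `g` has constant derivative, the chain rule has no term in its second derivative. It serves
for projections and for slice inclusions. -/
theorem fderiv_fderiv_comp_affine {F F' : Type*} [NormedAddCommGroup F] [NormedSpace ℝ F]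
    [NormedAddCommGroup F'] [NormedSpace ℝ F'] {ψ : F → ℝ} (L : F' →L[ℝ] F) {g : F' → F}
    (hg : ∀ u, HasFDerivAt g L u) {u : F'} (hψ : ContDiffAt ℝ ∞ ψ (g u)) (v w : F') :
    fderiv ℝ (fderiv ℝ (ψ ∘ g)) u v w = fderiv ℝ (fderiv ℝ ψ) (g u) (L v) (L w) := by
  have h1 : fderiv ℝ (ψ ∘ g) =ᶠ[nhds u]
      (ContinuousLinearMap.compL ℝ F' F ℝ).flip L ∘ fderiv ℝ ψ ∘ g := by
    have h : ∀ᶠ y in nhds (g u), DifferentiableAt ℝ ψ y :=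
      ((hψ.of_le (m := 1) (by simp)).eventually (by simp)).mono
        fun y hy => hy.differentiableAt (by simp)
    filter_upwards [(hg u).continuousAt.eventually h] with y hy
    exact (hy.hasFDerivAt.comp y (hg y)).fderiv
  have h2 : DifferentiableAt ℝ (fderiv ℝ ψ) (g u) :=
    (hψ.fderiv_right (m := 1) 
      (show ((2 : ℕ∞) : ℕ∞ω) ≤ ((⊤ : ℕ∞) : ℕ∞ω) from WithTop.coe_le_coe.2 le_top)).differentiableAt (by simp)
  rw [h1.fderiv_eq, ((ContinuousLinearMap.hasFDerivAt _).comp u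
    (h2.hasFDerivAt.comp u (hg u))).fderiv]
  rfl

end Smooth

/-! ### Admissibility is invariant under adding constants -/

section Admissible

variable {E M : Type*} [NormedAddCommGroup E] [NormedSpace ℂ E] [TopologicalSpace M]
  [ChartedSpace E M] {Ω : TwoForm E M} {φ : M → ℝ}

theorem IsAdmissible.sub_const (h : IsAdmissible Ω φ) (c : ℝ) :
    IsAdmissible Ω fun x => φ x - c := by
  refine ⟨?_, fun x v hv => ?_⟩
  · obtain ⟨h1, h2⟩ := contMDiff_real_iff.1 h.smooth
    exact contMDiff_real_iff.2 ⟨h1.sub continuous_const, fun x => (h2 x).sub contDiffAt_const⟩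
  · have : iddbar (E := E) (fun x => φ x - c) = iddbar φ := by
      ext x v w
      have hcomp : (fun x => φ x - c) ∘ (chartAt E x).symm =
        fun y => (φ ∘ (chartAt E x).symm) y - c := rfl
      have hd (f : E → ℝ) : fderiv ℝ (fun y => f y - c) = fderiv ℝ f :=
        funext fun y => fderiv_sub_const c
      simp only [iddbar, hcomp, hd]
    rw [this]
    exact h.pos x v hv

theorem IsAdmissible.continuous (h : IsAdmissible Ω φ) : Continuous φ := h.smooth.continuous

end Admissible

/-! ### Admissible functions: pullback from a factor, restriction to a slice -/

section Product

variable {ι : Type*} [Fintype ι] {E M : ι → Type*} [∀ i, NormedAddCommGroup (E i)]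
  [∀ i, NormedSpace ℂ (E i)] [∀ i, TopologicalSpace (M i)] [∀ i, ChartedSpace (E i) (M i)]
  {Ω : ∀ i, TwoForm (E i) (M i)}

omit [∀ i, TopologicalSpace (M i)] [∀ i, ChartedSpace (E i) (M i)] in
theorem TwoForm.directSum_apply (x : ∀ i, M i) (v w : ∀ i, E i) :
    TwoForm.directSum Ω x ![v, w] = ∑ i, Ω i (x i) ![v i, w i] := by
  rw [TwoForm.directSum, ContinuousAlternatingMap.sum_apply]
  refine Finset.sum_congr rfl fun i _ => ?_
  rw [ContinuousAlternatingMap.compContinuousLinearMap_apply]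
  congr 1
  ext k
  fin_cases k <;> rfl

theorem IsAdmissible.comp_eval (hΩ : ∀ i, IsKahlerForm (Ω i)) {i : ι} {φ : M i → ℝ}
    (h : IsAdmissible (Ω i) φ) :
    IsAdmissible (TwoForm.directSum Ω) fun x => φ (x i) := by
  obtain ⟨h1, h2⟩ := contMDiff_real_iff.1 h.smooth
  have hcomp (x : ∀ i, M i) : (fun x => φ (x i)) ∘ (chartAt (∀ i, E i) x).symm =
      (φ ∘ (chartAt (E i) (x i)).symm) ∘ ContinuousLinearMap.proj (R := ℝ) (φ := E) i := rfl
  refine ⟨contMDiff_real_iff.2 ⟨h1.comp (continuous_apply i), fun x => ?_⟩, fun x v hv => ?_⟩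
  · rw [hcomp]
    exact ContDiffAt.comp (chartAt (∀ i, E i) x x) (h2 (x i))
      (ContinuousLinearMap.proj (R := ℝ) (φ := E) i).contDiff.contDiffAt
  · have hi (w : ∀ i, E i) : iddbar (fun x : ∀ i, M i => φ (x i)) x v w =
        iddbar φ (x i) (v i) (w i) := by
      have := fderiv_fderiv_comp_affine (ContinuousLinearMap.proj (R := ℝ) (φ := E) i)
        (fun u => ContinuousLinearMap.hasFDerivAt _) (u := chartAt (∀ i, E i) x x) (h2 (x i))
      simp only [iddbar, hcomp, this]
      rfl
    classical
    rw [hi, TwoForm.directSum_apply, ← Finset.sum_erase_add _ _ (Finset.mem_univ i), add_assoc]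
    have hnn (j : ι) : 0 ≤ Ω j (x j) ![v j, (Complex.I • v) j] := by
      by_cases hj : v j = 0
      · exact ((Ω j (x j)).map_coord_zero 0 hj).ge
      · exact ((hΩ j).pos _ _ hj).le
    -- If `v i = 0` the Hessian term vanishes, and strict positivity comes from another factor's
    -- form.
    by_cases hvi : v i = 0
    · obtain ⟨j, hj⟩ := Function.ne_iff.1 hv
      have hij : j ≠ i := fun hij => hj (hij ▸ hvi)
      have h0 : iddbar φ (x i) (v i) ((Complex.I • v) i) = 0 := by
        simp [iddbar, hvi]
      rw [h0, add_zero]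
      refine add_pos_of_pos_of_nonneg (Finset.sum_pos' (fun j _ => hnn j)
        ⟨j, by simp [hij], (hΩ j).pos _ _ hj⟩) (hnn i)
    · exact add_pos_of_nonneg_of_pos (Finset.sum_nonneg fun j _ => hnn j) (h.pos _ _ hvi)

theorem IsAdmissible.comp_update [DecidableEq ι] {φ : (∀ i, M i) → ℝ}
    (h : IsAdmissible (TwoForm.directSum Ω) φ) (z : ∀ i, M i) (i : ι) :
    IsAdmissible (Ω i) fun t => φ (Function.update z i t) := by
  obtain ⟨h1, h2⟩ := contMDiff_real_iff.1 h.smooth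
  have hg (c : ∀ i, E i) (u : E i) : HasFDerivAt (Function.update c i)
      (ContinuousLinearMap.single ℝ E i) u := by
    convert hasFDerivAt_update (𝕜 := ℝ) c u using 1
    ext w j
    by_cases hj : j = i
    · subst hj; simp
    · simp [hj]
  -- In preferred charts the slice inclusion is the affine map updating coordinate `i`, sending
  -- centre to centre.
  have hchart (t : M i) : Function.update
      (chartAt (∀ i, E i) (Function.update z i t) (Function.update z i t)) i (chartAt (E i) t t) =
      chartAt (∀ i, E i) (Function.update z i t) (Function.update z i t) := by
    refine Function.update_eq_self_iff.2 ?_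
    change _ = chartAt (E i) (Function.update z i t i) (Function.update z i t i)
    rw [Function.update_self]
  have hcomp (t : M i) : (fun t => φ (Function.update z i t)) ∘ (chartAt (E i) t).symm =
      (φ ∘ (chartAt (∀ i, E i) (Function.update z i t)).symm) ∘ Function.update
        (chartAt (∀ i, E i) (Function.update z i t) (Function.update z i t)) i := by
    ext u
    refine congrArg φ (funext fun j => ?_)
    change _ = (chartAt (E j) (Function.update z i t j)).symm _
    by_cases hj : j = i
    · subst hj
      simp
    · have hj' : Function.update
          (chartAt (∀ i, E i) (Function.update z i t) (Function.update z i t)) i u j =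
          chartAt (E j) (Function.update z i t j) (Function.update z i t j) :=
        Function.update_of_ne hj _ _
      rw [hj', (chartAt (E j) _).left_inv (mem_chart_source (E j) _), Function.update_of_ne hj,
        Function.update_of_ne hj]
  refine ⟨contMDiff_real_iff.2 ⟨h1.comp (continuous_const.update i continuous_id), fun t => ?_⟩,
    fun t v hv => ?_⟩
  · rw [hcomp]
    refine ContDiffAt.comp _ (by rw [hchart]; exact h2 _) ?_
    exact (contDiff_update ∞ _ i).contDiffAt
  · have hi (w : E i) : iddbar (fun t => φ (Function.update z i t)) t v w =
        iddbar φ (Function.update z i t) (Pi.single i v) (Pi.single i w) := by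
      have := fderiv_fderiv_comp_affine (ContinuousLinearMap.single ℝ E i) (hg _)
        (u := chartAt (E i) t t) (by rw [hchart]; exact h2 (Function.update z i t))
      simp only [iddbar, hcomp, this, hchart, ContinuousLinearMap.single_apply, Pi.single_smul]
    have hpos := h.pos (Function.update z i t) (Pi.single i v) (by simpa using hv)
    rw [TwoForm.directSum_apply, Finset.sum_eq_single i, ← Pi.single_smul, ← hi] at hpos
    · simpa using hpos
    · intro j _ hj
      exact (Ω j _).map_coord_zero 0 (Pi.single_eq_of_ne hj _)
    · simp

end Product

/-! ### Exponents with a uniform exponential bound -/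

section Alpha

/-- `a` is a uniform exponential integrability exponent: `∫ exp (-a φ) dV` is bounded over all
`Ω`-admissible `φ` with `sup φ ≥ 0`. -/
def TwoForm.HasExpBound {E M : Type*} [NormedAddCommGroup E] [NormedSpace ℂ E]
    [TopologicalSpace M] [ChartedSpace E M] [FiniteDimensional ℂ E] [MeasurableSpace M]
    (Ω : TwoForm E M) (a : ℝ≥0) : Prop :=
  ∃ C : ℝ≥0, ∀ φ : M → ℝ, IsAdmissible Ω φ → 0 ≤ ⨆ x, φ x →
    ∫⁻ x, ENNReal.ofReal (Real.exp (-(a * φ x))) ∂Ω.volume ≤ C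

variable {E M : Type*} [NormedAddCommGroup E] [NormedSpace ℂ E]
  [TopologicalSpace M] [ChartedSpace E M] [FiniteDimensional ℂ E] [MeasurableSpace M]
  {Ω : TwoForm E M} {a b : ℝ≥0}

theorem TwoForm.HasExpBound.le_alpha (h : Ω.HasExpBound a) : (a : ℝ≥0∞) ≤ Ω.alpha :=
  le_iSup₂ (f := fun (a : ℝ≥0) (_ : Ω.HasExpBound a) => (a : ℝ≥0∞)) a h

theorem TwoForm.alpha_le {c : ℝ≥0∞} (h : ∀ a : ℝ≥0, Ω.HasExpBound a → (a : ℝ≥0∞) ≤ c) :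
    Ω.alpha ≤ c :=
  iSup₂_le h

/-- For `0 ≤ b ≤ a`, `exp (-b φ) ≤ 1 + exp (-a φ)` whatever the sign of `φ`, and the volume is
finite. -/
theorem TwoForm.HasExpBound.mono [IsFiniteMeasure Ω.volume] (h : Ω.HasExpBound a) (hb : b ≤ a) :
    Ω.HasExpBound b := by
  obtain ⟨C, hC⟩ := h
  refine ⟨(Ω.volume Set.univ).toNNReal + C, fun φ hφ hs => ?_⟩
  rw [ENNReal.coe_add, ENNReal.coe_toNNReal (measure_ne_top _ _)]
  calc ∫⁻ x, ENNReal.ofReal (Real.exp (-(b * φ x))) ∂Ω.volume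
      ≤ ∫⁻ x, 1 + ENNReal.ofReal (Real.exp (-(a * φ x))) ∂Ω.volume := by
        refine lintegral_mono fun x => ?_
        rw [← ENNReal.ofReal_one, ← ENNReal.ofReal_add zero_le_one (Real.exp_pos _).le]
        refine ENNReal.ofReal_le_ofReal ?_
        rcases le_total 0 (φ x) with hx | hx
        · have : Real.exp (-(b * φ x)) ≤ 1 :=
            Real.exp_le_one_iff.2 (neg_nonpos.2 (mul_nonneg b.2 hx))
          linarith [Real.exp_pos (-(a * φ x))]
        · have : Real.exp (-(b * φ x)) ≤ Real.exp (-(a * φ x)) :=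
            Real.exp_le_exp.2 (neg_le_neg (mul_le_mul_of_nonpos_right hb hx))
          linarith
    _ = Ω.volume Set.univ + ∫⁻ x, ENNReal.ofReal (Real.exp (-(a * φ x))) ∂Ω.volume := by
        rw [lintegral_add_left measurable_const]
        simp
    _ ≤ _ := add_le_add le_rfl (hC φ hφ hs)

theorem TwoForm.HasExpBound.lt_of_lt_alpha [IsFiniteMeasure Ω.volume]
    (h : (b : ℝ≥0∞) < Ω.alpha) : Ω.HasExpBound b := by
  by_contra hb
  refine h.not_ge (TwoForm.alpha_le fun a ha => ?_)
  by_contra hab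
  exact hb (ha.mono (by exact_mod_cast (not_le.1 hab).le))

/-- Normalising at a point gives a Harnack-type bound for the exponential integral. -/
theorem TwoForm.HasExpBound.exists_le [CompactSpace M] (h : Ω.HasExpBound a) :
    ∃ C : ℝ≥0, ∀ φ : M → ℝ, IsAdmissible Ω φ → ∀ p : M,
      ∫⁻ x, ENNReal.ofReal (Real.exp (-(a * φ x))) ∂Ω.volume ≤
        C * ENNReal.ofReal (Real.exp (-(a * φ p))) := by
  obtain ⟨C, hC⟩ := h
  refine ⟨C, fun φ hφ p => ?_⟩
  have hψ := hφ.sub_const (φ p)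
  -- The shifted function vanishes at `p`; compactness ensures that the real supremum is a genuine
  -- one.
  have hsup : 0 ≤ ⨆ x, (φ x - φ p) :=
    le_ciSup_of_le (isCompact_range hψ.continuous).bddAbove p (by simp)
  calc ∫⁻ x, ENNReal.ofReal (Real.exp (-(a * φ x))) ∂Ω.volume
      = ∫⁻ x, ENNReal.ofReal (Real.exp (-(a * (φ x - φ p)))) *
          ENNReal.ofReal (Real.exp (-(a * φ p))) ∂Ω.volume := by
        refine lintegral_congr fun x => ?_
        rw [← ENNReal.ofReal_mul (Real.exp_pos _).le, ← Real.exp_add]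
        congr 2
        ring
    _ = (∫⁻ x, ENNReal.ofReal (Real.exp (-(a * (φ x - φ p)))) ∂Ω.volume) *
          ENNReal.ofReal (Real.exp (-(a * φ p))) :=
        lintegral_mul_const' _ _ ENNReal.ofReal_ne_top
    _ ≤ _ := by gcongr; exact hC _ hψ hsup

end Alpha

/-! ### Transfer of the exponential bound between factors and product -/

section AlphaProduct

variable {ι : Type*} [Fintype ι] {E M : ι → Type*}
    [∀ i, NormedAddCommGroup (E i)] [∀ i, NormedSpace ℂ (E i)] [∀ i, FiniteDimensional ℂ (E i)]
    [∀ i, TopologicalSpace (M i)] [∀ i, ChartedSpace (E i) (M i)]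
    [∀ i, IsManifold 𝓘(ℂ, E i) ω (M i)]
    [∀ i, CompactSpace (M i)] [∀ i, Nonempty (M i)]
    [∀ i, MeasurableSpace (M i)] [∀ i, BorelSpace (M i)]
    {Ω : ∀ i, TwoForm (E i) (M i)} {a : ℝ≥0}

theorem TwoForm.HasExpBound.of_directSum (hΩ : ∀ i, IsKahlerForm (Ω i))
    (h : (TwoForm.directSum Ω).HasExpBound a) (i : ι) : (Ω i).HasExpBound a := by
  classical
  have _ (i : ι) : IsFiniteMeasure (Ω i).volume := (hΩ i).isFiniteMeasure_volume
  obtain ⟨C, hC⟩ := h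
  set V : ℝ≥0∞ := ∏ j ∈ Finset.univ.erase i, (Ω j).volume Set.univ with hV
  have hV0 : V ≠ 0 := Finset.prod_ne_zero_iff.2 fun j _ => (hΩ j).volume_univ_ne_zero
  have hVtop : V ≠ ⊤ := ENNReal.prod_ne_top fun j _ => measure_ne_top _ _
  refine ⟨(C / V).toNNReal, fun φ hφ hs => ?_⟩
  rw [ENNReal.coe_toNNReal (ENNReal.div_ne_top ENNReal.coe_ne_top hV0),
    ENNReal.le_div_iff_mul_le (.inl hV0) (.inl hVtop), mul_comm]
  have hφm : Measurable fun x => ENNReal.ofReal (Real.exp (-(a * φ x))) := by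
    have := hφ.continuous
    exact (Continuous.measurable (f := fun x => Real.exp (-(a * φ x))) (by fun_prop)).ennreal_ofReal
  have hsup : 0 ≤ ⨆ x : ∀ i, M i, φ (x i) := by
    rwa [(Function.surjective_eval i).iSup_comp φ]
  refine le_of_eq_of_le ?_ (hC _ (hφ.comp_eval hΩ) hsup)
  -- The product measure projects to `V` times the volume of factor `i`.
  rw [TwoForm.volume_directSum hΩ, ← smul_eq_mul, hV, ← lintegral_smul_measure,
    ← Measure.pi_map_eval, lintegral_map hφm (measurable_pi_apply i)]

theorem TwoForm.HasExpBound.directSum (hΩ : ∀ i, IsKahlerForm (Ω i))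
    (h : ∀ i, (Ω i).HasExpBound a) : (TwoForm.directSum Ω).HasExpBound a := by
  classical
  have _ (i : ι) : IsFiniteMeasure (Ω i).volume := (hΩ i).isFiniteMeasure_volume
  have _ (i : ι) : ProperSpace (E i) := FiniteDimensional.proper_real (E i)
  -- With this, continuous functions are measurable for the product σ-algebra.
  have _ (i : ι) : SecondCountableTopology (M i) :=
    ChartedSpace.secondCountable_of_sigmaCompact (E i) (M i)
  choose C hC using fun i => (h i).exists_le
  refine ⟨∏ i, C i, fun φ hφ hs => ?_⟩
  obtain ⟨p, hp⟩ : ∃ p, φ p = ⨆ x, φ x :=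
    (isCompact_range hφ.continuous).sSup_mem (Set.range_nonempty φ)
  let F : (∀ i, M i) → ℝ≥0∞ := fun x => ENNReal.ofReal (Real.exp (-(a * φ x)))
  have hF : Measurable F := by
    have := hφ.continuous
    exact (Continuous.measurable (f := fun x => Real.exp (-(a * φ x))) (by fun_prop)).ennreal_ofReal
  -- Coordinates in `s` have been integrated and are frozen at `p`; the others remain those of `x`.
  have key (s : Finset ι) (x : ∀ i, M i) : lmarginal (fun i => (Ω i).volume) s F x ≤
      (∏ i ∈ s, (C i : ℝ≥0∞)) * F (fun i => if i ∈ s then p i else x i) := by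
    induction s using Finset.induction_on generalizing x with
    | empty => simp
    | insert i s hi ih =>
      rw [lmarginal_insert _ hF hi, Finset.prod_insert hi]
      set y : ∀ i, M i := fun i => if i ∈ s then p i else x i with hy
      have hupd (t : M i) : (fun j => if j ∈ s then p j else Function.update x i t j) =
          Function.update y i t := by
        ext j
        by_cases hj : j = i
        · subst hj; simp [hi]
        · simp [hj, hy]
      have hupd' : (fun j => if j ∈ insert i s then p j else x j) =
          Function.update y i (p i) := by
        ext j
        by_cases hj : j = i
        · subst hj; simp
        · simp [hj, hy]
      calc ∫⁻ t, lmarginal (fun i => (Ω i).volume) s F (Function.update x i t) ∂(Ω i).volume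
          ≤ ∫⁻ t, (∏ i ∈ s, (C i : ℝ≥0∞)) * F (Function.update y i t) ∂(Ω i).volume :=
            lintegral_mono fun t => hupd t ▸ ih (Function.update x i t)
        _ = (∏ i ∈ s, (C i : ℝ≥0∞)) * ∫⁻ t, F (Function.update y i t) ∂(Ω i).volume :=
            lintegral_const_mul _ (hF.comp (measurable_update y))
        _ ≤ (∏ i ∈ s, (C i : ℝ≥0∞)) * (C i * F (Function.update y i (p i))) := by
            gcongr
            -- The bound on the slice is based at `p i`, which need not maximise `φ` on that slice.
            exact hC i _ (hφ.comp_update y i) (p i)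
        _ = _ := by rw [hupd']; ring
  rw [TwoForm.volume_directSum hΩ, lintegral_eq_lmarginal_univ p]
  refine (key Finset.univ p).trans ?_
  have hF1 : F p ≤ 1 := by
    refine ENNReal.ofReal_le_one.2 (Real.exp_le_one_iff.2 (neg_nonpos.2 (mul_nonneg a.2 ?_)))
    rwa [hp]
  simpa using mul_le_mul_right hF1 (∏ i, (C i : ℝ≥0∞))

end AlphaProduct

end

/-- Tian's invariant of a product of compact Kähler manifolds is the infimum of the invariants of
the factors. -/
theorem mainTheorem4 {ι : Type*} [Fintype ι] {E M : ι → Type*}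
    [∀ i, NormedAddCommGroup (E i)] [∀ i, NormedSpace ℂ (E i)] [∀ i, FiniteDimensional ℂ (E i)]
    [∀ i, TopologicalSpace (M i)] [∀ i, ChartedSpace (E i) (M i)]
    [∀ i, IsManifold 𝓘(ℂ, E i) ω (M i)]
    [∀ i, T2Space (M i)] [∀ i, CompactSpace (M i)] [∀ i, Nonempty (M i)]
    [∀ i, MeasurableSpace (M i)] [∀ i, BorelSpace (M i)]
    (Ω : ∀ i, TwoForm (E i) (M i)) (hΩ : ∀ i, IsKahlerForm (Ω i)) :
    (TwoForm.directSum Ω).alpha = ⨅ i, (Ω i).alpha := by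
  have _ (i : ι) : IsFiniteMeasure (Ω i).volume := (hΩ i).isFiniteMeasure_volume
  refine le_antisymm (TwoForm.alpha_le fun a ha => le_iInf fun i =>
    (ha.of_directSum hΩ i).le_alpha) (le_of_forall_lt_imp_le_of_dense fun c hc => ?_)
  -- The suprema need not be attained, so only exponents strictly below the infimum are tested; by
  -- `mono` each of them works on every factor.
  lift c to ℝ≥0 using hc.ne_top
  exact (TwoForm.HasExpBound.directSum hΩ fun i =>
    .lt_of_lt_alpha (hc.trans_le (iInf_le _ i))).le_alpha
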